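/- Let $\mathbb K$ be a subfield of $\mathbb C$, let $I$ be a countable set, and let $A=(a_{ij})_{i,j\in I}$ be a symmetric matrix with real entries in $\mathbb K$ such that $a_{ij}\le 0$ for $i\ne j$, and $2a_{ij}/a_{ii}\in\mathbb Z$ for all $j\in I$ whenever $a_{ii}>0$. Let $J=\{i\in I\mid a_{ii}>0\}$ and assume that $a_{ij}<0$ for all $i,j\in I\setminus J$ with $i\neq j$. Let $\mathfrak g$ be the Borcherds algebra of $A$, i.e. the Lie algebra over $\mathbb K$ with generators $h_i,e_i,f_i$ ($i\in I$) and relations $[h_i,h_j]=0$, $[h_i,e_k]=a_{ik}e_k$, $[h_i,f_k]=-a_{ik}f_k$, $[e_i,f_j]=\delta_{ij}h_i$, $(\operatorname{ad}e_i)^{1-2a_{ij}/a_{ii}}e_j=0=(\operatorname{ad}f_i)^{1-2a_{ij}/a_{ii}}f_j$ for $i\ne j$ with $a_{ii}>0$, and $[e_i,e_j]=0=[f_i,f_j]$ if $a_{ij}=0$. It is graded by the root lattice $Q=\bigoplus_{i\in I}\mathbb Z\alpha_i$ with $\deg h_i=0$, $\deg e_i=\alpha_i$, $\deg f_i=-\alpha_i$.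 Let $\mathfrak g_J$ be the Kac–Moody (or semisimple) algebra, defined by the same presentation, of the matrix $(a_{ij})_{i,j\in J}$; it is graded by $\bigoplus_{j\in J}\mathbb Z\alpha_j\subset Q$. Let $\mathfrak h_J$ be the span of its $h_j$ and $\mathfrak n_J^-$ the subalgebra generated by its $f_j$ ($j\in J$), and let $\mathfrak g_J$ act on $\mathfrak g$ through the canonical homomorphism $\mathfrak g_J\to\mathfrak g$ and the adjoint action. Put $$V'=\coprod_{i\in I\setminus J}U(\mathfrak n_J^-)\cdot f_i,$$ a $\mathfrak g_J$-module with the $Q$-grading inherited from $\mathfrak g$. Endow the tensor algebra $T(V')$ over $\mathbb K$ with the usual action of $\mathfrak g_J$ on tensor products and with the induced $Q$-grading, in which $v_1\otimes\cdots\otimes v_n$ has degree $\beta_1+\dots+\beta_n$ if each $v_k$ is homogeneous of degree $\beta_k$. Then $T(V')$ is a $Q$-graded integrable $\mathfrak g_J$-module with finite-dimensional homogeneous subspaces. That is: 1. $T(V')$ is an integrable $\mathfrak g_J$-module: it is the direct sum of its $\mathfrak h_J$-weight spaces, and every $e_j$ and $f_j$ ($j\in J$) acts locally nilpotently on it. 2.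 $T(V')=\bigoplus_{\beta\in Q}T(V')_\beta$ is a $Q$-graded algebra and a $Q$-graded $\mathfrak g_J$-module, i.e. $1\in T(V')_0$, $T(V')_\beta\, T(V')_\gamma\subseteq T(V')_{\beta+\gamma}$ and $(\mathfrak g_J)_\alpha\cdot T(V')_\beta\subseteq T(V')_{\alpha+\beta}$; moreover $h_j$ ($j\in J$) acts on $T(V')_\beta$, $\beta=\sum_i n_i\alpha_i$, as the scalar $\beta(h_j)=\sum_i n_ia_{ji}$. 3. Every $T(V')_\beta$, $\beta\in Q$, is finite-dimensional. -/

import Mathlib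

open scoped DirectSum

noncomputable section

namespace Borcherds

attribute [local instance] LieRing.ofAssociativeRing

/-! ### The Borcherds algebra of a matrix -/

section Algebra

variable {K : Subfield ℂ} {I : Type*}

/-- Conditions (B1)--(B3) on a matrix over a subfield `K` of `ℂ`. The entries are real numbers
(they are compared with `0`). -/
structure IsBorcherdsMatrix (A : Matrix I I K) : Prop where
  real : ∀ i j, (A i j : ℂ).im = 0
  symm : ∀ i j, A i j = A j i
  nonpos : ∀ i j, i ≠ j → (A i j : ℂ).re ≤ 0
  integral : ∀ i, 0 < (A i i : ℂ).re → ∀ j, ∃ m : ℤ, 2 * A i j / A i i = (m : K)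

variable (I) in
/-- The generators `h i`, `e i`, `f i`. -/
inductive Gen : Type _
  | h (i : I) : Gen
  | e (i : I) : Gen
  | f (i : I) : Gen

variable (K) in
/-- The generators inside the free Lie algebra. -/
abbrev gen (x : Gen I) : FreeLieAlgebra K (Gen I) := FreeLieAlgebra.of K x

/-- The defining relators of the Borcherds algebra. In the Serre relations `n` is the natural
number `-2 a_ij / a_ii`. -/
inductive Relator (A : Matrix I I K) : FreeLieAlgebra K (Gen I) → Prop
  | hh (i j : I) : Relator A ⁅gen K (.h i), gen K (.h j)⁆
  | he (i k : I) : Relator A (⁅gen K (.h i), gen K (.e k)⁆ - A i k • gen K (.e k))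
  | hf (i k : I) : Relator A (⁅gen K (.h i), gen K (.f k)⁆ + A i k • gen K (.f k))
  | ef_self (i : I) : Relator A (⁅gen K (.e i), gen K (.f i)⁆ - gen K (.h i))
  | ef_ne (i j : I) (hij : i ≠ j) : Relator A ⁅gen K (.e i), gen K (.f j)⁆
  | serre_e (i j : I) (n : ℕ) (hij : i ≠ j) (hi : 0 < (A i i : ℂ).re)
      (hn : (n : K) = -2 * A i j / A i i) :
      Relator A (((LieAlgebra.ad K (FreeLieAlgebra K (Gen I)) (gen K (.e i))) ^ (n + 1))
        (gen K (.e j)))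
  | serre_f (i j : I) (n : ℕ) (hij : i ≠ j) (hi : 0 < (A i i : ℂ).re)
      (hn : (n : K) = -2 * A i j / A i i) :
      Relator A (((LieAlgebra.ad K (FreeLieAlgebra K (Gen I)) (gen K (.f i))) ^ (n + 1))
        (gen K (.f j)))
  | ee (i j : I) (hij : A i j = 0) : Relator A ⁅gen K (.e i), gen K (.e j)⁆
  | ff (i j : I) (hij : A i j = 0) : Relator A ⁅gen K (.f i), gen K (.f j)⁆

/-- The ideal of the free Lie algebra generated by the relators. -/
def relatorIdeal (A : Matrix I I K) : LieIdeal K (FreeLieAlgebra K (Gen I)) :=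
  LieSubmodule.lieSpan K (FreeLieAlgebra K (Gen I)) {x | Relator A x}

/-- The Borcherds algebra `𝔤(A)`, given by generators and relations. -/
def BorcherdsAlgebra (A : Matrix I I K) : Type _ :=
  FreeLieAlgebra K (Gen I) ⧸ relatorIdeal A

instance (A : Matrix I I K) : LieRing (BorcherdsAlgebra A) :=
  inferInstanceAs (LieRing (FreeLieAlgebra K (Gen I) ⧸ relatorIdeal A))

instance (A : Matrix I I K) : LieAlgebra K (BorcherdsAlgebra A) :=
  inferInstanceAs (LieAlgebra K (FreeLieAlgebra K (Gen I) ⧸ relatorIdeal A))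

/-- The quotient map from the free Lie algebra. -/
def proj (A : Matrix I I K) : FreeLieAlgebra K (Gen I) →ₗ⁅K⁆ BorcherdsAlgebra A :=
  { ((relatorIdeal A : Submodule K (FreeLieAlgebra K (Gen I))).mkQ :
      FreeLieAlgebra K (Gen I) →ₗ[K] (FreeLieAlgebra K (Gen I) ⧸ relatorIdeal A)) with
    map_lie' := fun {_ _} => rfl }

variable (A : Matrix I I K)

/-- The Chevalley generators of `𝔤(A)`. -/
def h (i : I) : BorcherdsAlgebra A := proj A (gen K (.h i))
/-- The Chevalley generators of `𝔤(A)`. -/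
def e (i : I) : BorcherdsAlgebra A := proj A (gen K (.e i))
/-- The Chevalley generators of `𝔤(A)`. -/
def f (i : I) : BorcherdsAlgebra A := proj A (gen K (.f i))

theorem proj_relator {x : FreeLieAlgebra K (Gen I)} (hx : Relator A x) : proj A x = 0 :=
  (Submodule.Quotient.mk_eq_zero _).2 (LieSubmodule.subset_lieSpan (R := K)
    (L := FreeLieAlgebra K (Gen I)) hx)

theorem lie_h_h (i j : I) : ⁅h A i, h A j⁆ = 0 := by
  have := proj_relator A (.hh i j)
  rwa [LieHom.map_lie] at this

theorem lie_h_e (i k : I) : ⁅h A i, e A k⁆ = A i k • e A k := by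
  have := proj_relator A (.he i k)
  rwa [map_sub, LieHom.map_lie, map_smul, sub_eq_zero] at this

theorem lie_h_f (i k : I) : ⁅h A i, f A k⁆ = -(A i k • f A k) := by
  have := proj_relator A (.hf i k)
  rwa [map_add, LieHom.map_lie, map_smul, add_eq_zero_iff_eq_neg] at this

theorem lie_e_f_self (i : I) : ⁅e A i, f A i⁆ = h A i := by
  have := proj_relator A (.ef_self i)
  rwa [map_sub, LieHom.map_lie, sub_eq_zero] at this

theorem lie_e_f_ne {i j : I} (hij : i ≠ j) : ⁅e A i, f A j⁆ = 0 := by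
  have := proj_relator A (.ef_ne i j hij)
  rwa [LieHom.map_lie] at this

theorem map_ad_pow {L L' : Type*} [LieRing L] [LieAlgebra K L] [LieRing L'] [LieAlgebra K L']
    (φ : L →ₗ⁅K⁆ L') (x y : L) (n : ℕ) :
    φ (((LieAlgebra.ad K L x) ^ n) y) = ((LieAlgebra.ad K L' (φ x)) ^ n) (φ y) := by
  induction n with
  | zero => simp
  | succ n ih => rw [pow_succ', pow_succ']; simp [ih]

/-- The universal property: a map on the generators whose extension to the free Lie algebra kills
the relators induces a homomorphism on `𝔤(A)`. -/
def lift {L : Type*} [LieRing L] [LieAlgebra K L] (φ : FreeLieAlgebra K (Gen I) →ₗ⁅K⁆ L)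
    (hφ : ∀ x, Relator A x → φ x = 0) : BorcherdsAlgebra A →ₗ⁅K⁆ L :=
  { ((relatorIdeal A : Submodule K (FreeLieAlgebra K (Gen I))).liftQ (φ : _ →ₗ[K] L) (by
      have : relatorIdeal A ≤ φ.ker := LieSubmodule.lieSpan_le.2 fun x hx => by
        simpa using hφ x hx
      intro x hx
      have := this hx
      simpa using this) :
      (FreeLieAlgebra K (Gen I) ⧸ relatorIdeal A) →ₗ[K] L) with
    map_lie' := by
      intro x y
      obtain ⟨x, rfl⟩ := Submodule.Quotient.mk_surjective _ x
      obtain ⟨y, rfl⟩ := Submodule.Quotient.mk_surjective _ y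
      exact φ.map_lie x y }

theorem lift_proj {L : Type*} [LieRing L] [LieAlgebra K L] (φ : FreeLieAlgebra K (Gen I) →ₗ⁅K⁆ L)
    (hφ : ∀ x, Relator A x → φ x = 0) (x : FreeLieAlgebra K (Gen I)) :
    lift A φ hφ (proj A x) = φ x := rfl

/-- `IsMonomial A β x` says that `x` is an iterated bracket of Chevalley generators of total degree
`β` in `Q = ⨁ ℤ α_i`, where `deg h_i = 0`, `deg e_i = α_i`, `deg f_i = -α_i`. -/
inductive IsMonomial : (I →₀ ℤ) → BorcherdsAlgebra A → Prop
  | h (i : I) : IsMonomial 0 (h A i)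
  | e (i : I) : IsMonomial (Finsupp.single i 1) (e A i)
  | f (i : I) : IsMonomial (-Finsupp.single i 1) (f A i)
  | lie {α β : I →₀ ℤ} {x y : BorcherdsAlgebra A} :
      IsMonomial α x → IsMonomial β y → IsMonomial (α + β) ⁅x, y⁆

/-- The homogeneous subspace of `𝔤(A)` of degree `β ∈ Q`, i.e. the joint eigenspace, with
eigenvalues `β_i`, of the degree derivations: the root space of `β` for `β ≠ 0`. -/
def rootSpace (β : I →₀ ℤ) : Submodule K (BorcherdsAlgebra A) :=
  Submodule.span K {x | IsMonomial A β x}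

/-- The Cartan subalgebra, spanned by the `h_i`. -/
def cartan : Submodule K (BorcherdsAlgebra A) := Submodule.span K (Set.range (h A))

/-- The subalgebra `𝔫⁻`, generated by the `f_i`. -/
def nMinus : LieSubalgebra K (BorcherdsAlgebra A) :=
  LieSubalgebra.lieSpan K (BorcherdsAlgebra A) (Set.range (f A))

section Integrable

variable (M : Type*) [AddCommGroup M] [Module K M] [LieRingModule (BorcherdsAlgebra A) M]
  [LieModule K (BorcherdsAlgebra A) M]

/-- The weight space of weight `μ` of a module over `𝔤(A)`, for a linear functional `μ` on the
Cartan subalgebra. -/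
def weightSpace (μ : Module.Dual K (cartan A)) : Submodule K M where
  carrier := {v | ∀ x : cartan A, ⁅(x : BorcherdsAlgebra A), v⁆ = μ x • v}
  add_mem' {v w} hv hw x := by rw [lie_add, hv x, hw x, smul_add]
  zero_mem' x := by simp
  smul_mem' c v hv x := by rw [lie_smul, hv x, smul_comm]

open scoped Classical in
/-- Integrability: the Cartan subalgebra acts diagonalizably, and `e_i`, `f_i` act locally
nilpotently for every real simple root `α_i`. -/
structure IsIntegrable : Prop where
  weight : DirectSum.IsInternal (weightSpace A M)
  e_nilpotent : ∀ i : I, 0 < (A i i : ℂ).re → ∀ v : M,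
    ∃ n : ℕ, ((LieModule.toEnd K (BorcherdsAlgebra A) M (e A i)) ^ n) v = 0
  f_nilpotent : ∀ i : I, 0 < (A i i : ℂ).re → ∀ v : M,
    ∃ n : ℕ, ((LieModule.toEnd K (BorcherdsAlgebra A) M (f A i)) ^ n) v = 0

end Integrable

/-! ### The Kac--Moody algebra `𝔤_J` and its action on `𝔤` -/

/-- `J`, the set of indices of real simple roots. -/
def J : Set I := {i | 0 < (A i i : ℂ).re}

/-- The generalized Cartan matrix (in symmetric form) `(a_ij)`, `i, j ∈ J`. -/
def cartanJ : Matrix (J A) (J A) K := A.submatrix Subtype.val Subtype.val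

/-- The Kac--Moody (or semisimple) algebra `𝔤_J` of the matrix `(a_ij)`, `i, j ∈ J`. -/
abbrev gJ : Type _ := BorcherdsAlgebra (cartanJ A)

/-- The inclusion of index sets on generators. -/
def genJ : Gen (J A) → BorcherdsAlgebra A
  | .h i => h A i
  | .e i => e A i
  | .f i => f A i

/-- The canonical homomorphism `𝔤_J → 𝔤`, sending `h_j, e_j, f_j` to `h_j, e_j, f_j`. Its image
is generated by the `e_j, f_j` with `j ∈ J`. -/
def toBorcherds : gJ A →ₗ⁅K⁆ BorcherdsAlgebra A :=
  lift (cartanJ A) (FreeLieAlgebra.lift K (genJ A)) (by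
    intro x hx
    cases hx with
    | hh i j => simpa [genJ] using lie_h_h A i j
    | he i k => simp [genJ, lie_h_e, cartanJ]
    | hf i k => simp [genJ, lie_h_f, cartanJ]
    | ef_self i => simp [genJ, lie_e_f_self]
    | ef_ne i j hij =>
      simpa [genJ] using lie_e_f_ne A (fun h => hij (Subtype.ext h))
    | serre_e i j n hij hi hn =>
      rw [map_ad_pow]
      have := proj_relator A
        (.serre_e i.1 j.1 n (fun h => hij (Subtype.ext h)) hi hn)
      rw [map_ad_pow] at this
      simpa only [FreeLieAlgebra.lift_of_apply] using! this
    | serre_f i j n hij hi hn =>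
      rw [map_ad_pow]
      have := proj_relator A
        (.serre_f i.1 j.1 n (fun h => hij (Subtype.ext h)) hi hn)
      rw [map_ad_pow] at this
      simpa only [FreeLieAlgebra.lift_of_apply] using! this
    | ee i j hij =>
      have := proj_relator A (.ee i.1 j.1 hij)
      rw [LieHom.map_lie] at this
      rw [LieHom.map_lie, FreeLieAlgebra.lift_of_apply, FreeLieAlgebra.lift_of_apply]
      exact this
    | ff i j hij =>
      have := proj_relator A (.ff i.1 j.1 hij)
      rw [LieHom.map_lie] at this
      rw [LieHom.map_lie, FreeLieAlgebra.lift_of_apply, FreeLieAlgebra.lift_of_apply]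
      exact this)

@[simp] theorem toBorcherds_h (j : J A) : toBorcherds A (h (cartanJ A) j) = h A j := by
  simp [toBorcherds, h, lift_proj, genJ]

@[simp] theorem toBorcherds_e (j : J A) : toBorcherds A (e (cartanJ A) j) = e A j := by
  simp [toBorcherds, e, lift_proj, genJ]

@[simp] theorem toBorcherds_f (j : J A) : toBorcherds A (f (cartanJ A) j) = f A j := by
  simp [toBorcherds, f, lift_proj, genJ]

/-- The action of `U(𝔫⁻_J)` on `𝔤` that extends the adjoint action. -/
def actU : UniversalEnvelopingAlgebra K (nMinus (cartanJ A)) →ₐ[K]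
    Module.End K (BorcherdsAlgebra A) :=
  UniversalEnvelopingAlgebra.lift K
    (((LieAlgebra.ad K (BorcherdsAlgebra A)).comp (toBorcherds A)).comp
      (nMinus (cartanJ A)).incl)

/-- The subspace `V'_i = U(𝔫⁻_J) · f_i` of `𝔤`. -/
def VprimeI (i : I) : Submodule K (BorcherdsAlgebra A) :=
  LinearMap.range ((LinearMap.applyₗ (f A i)) ∘ₗ (actU A).toLinearMap)

theorem mem_VprimeI {i : I} {v : BorcherdsAlgebra A} :
    v ∈ VprimeI A i ↔ ∃ u, actU A u (f A i) = v := Iff.rfl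

theorem f_mem_VprimeI (i : I) : f A i ∈ VprimeI A i := ⟨1, by simp⟩

theorem actU_ι (x : nMinus (cartanJ A)) (v : BorcherdsAlgebra A) :
    actU A (UniversalEnvelopingAlgebra.ι K x) v = ⁅toBorcherds A x, v⁆ := by
  simp [actU]

theorem nMinus_lie_mem {i : I} {x : gJ A} (hx : x ∈ nMinus (cartanJ A))
    {v : BorcherdsAlgebra A} (hv : v ∈ VprimeI A i) : ⁅toBorcherds A x, v⁆ ∈ VprimeI A i := by
  obtain ⟨u, rfl⟩ := (mem_VprimeI A).1 hv
  refine (mem_VprimeI A).2 ⟨UniversalEnvelopingAlgebra.ι K ⟨x, hx⟩ * u, ?_⟩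
  rw [map_mul, Module.End.mul_apply, actU_ι]

/-- The elements of `𝔤_J` that preserve a subspace of `𝔤`. -/
def stab (N : Submodule K (BorcherdsAlgebra A)) : LieSubalgebra K (gJ A) where
  carrier := {x | ∀ v ∈ N, ⁅toBorcherds A x, v⁆ ∈ N}
  add_mem' {x y} hx hy v hv := by
    rw [map_add, add_lie]; exact N.add_mem (hx v hv) (hy v hv)
  zero_mem' v hv := by simp
  smul_mem' c x hx v hv := by
    rw [map_smul, smul_lie]; exact N.smul_mem c (hx v hv)
  lie_mem' {x y} hx hy v hv := by
    rw [LieHom.map_lie, lie_lie]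
    exact N.sub_mem (hx _ (hy v hv)) (hy _ (hx v hv))

/-- Induction principle for `V'_i`. -/
theorem VprimeI_le {i : I} (N : Submodule K (BorcherdsAlgebra A)) (h0 : f A i ∈ N)
    (hf : ∀ j : J A, ∀ v ∈ N, ⁅f A j, v⁆ ∈ N) : VprimeI A i ≤ N := by
  have hn : nMinus (cartanJ A) ≤ stab A N := LieSubalgebra.lieSpan_le.2 (by
    rintro _ ⟨j, rfl⟩ v hv
    rw [toBorcherds_f]; exact hf j v hv)
  let S : Subalgebra K (Module.End K (BorcherdsAlgebra A)) :=
    { carrier := {T | ∀ v ∈ N, T v ∈ N}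
      mul_mem' := fun {a b} ha hb v hv => ha _ (hb v hv)
      add_mem' := fun {a b} ha hb v hv => N.add_mem (ha v hv) (hb v hv)
      algebraMap_mem' := fun r v hv => by
        simpa [Module.algebraMap_end_apply] using N.smul_mem r hv }
  let g : nMinus (cartanJ A) →ₗ⁅K⁆ S :=
    { toFun := fun x => ⟨LieAlgebra.ad K _ (toBorcherds A x), fun v hv => hn x.2 v hv⟩
      map_add' := fun x y => Subtype.ext (by simp)
      map_smul' := fun c x => Subtype.ext (by simp)
      map_lie' := fun {x y} => Subtype.ext (by
        simp [LieRing.of_associative_ring_bracket]) }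
  have hS : actU A = S.val.comp (UniversalEnvelopingAlgebra.lift K g) := by
    apply UniversalEnvelopingAlgebra.hom_ext
    ext x v
    simp [actU, g]
  rintro _ ⟨u, rfl⟩
  have := (UniversalEnvelopingAlgebra.lift K g u).2 _ h0
  simpa [hS] using this

theorem closure_gJ : LieSubalgebra.lieSpan K (gJ A)
    (Set.range (e (cartanJ A)) ∪ Set.range (f (cartanJ A))) = ⊤ := by
  set S := LieSubalgebra.lieSpan K (gJ A)
    (Set.range (e (cartanJ A)) ∪ Set.range (f (cartanJ A))) with hS
  have he (j) : e (cartanJ A) j ∈ S := LieSubalgebra.subset_lieSpan (.inl ⟨j, rfl⟩)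
  have hf (j) : f (cartanJ A) j ∈ S := LieSubalgebra.subset_lieSpan (.inr ⟨j, rfl⟩)
  have hh (j) : h (cartanJ A) j ∈ S := by
    rw [← lie_e_f_self]; exact S.lie_mem (he j) (hf j)
  let g : Gen (J A) → S := fun x => match x with
    | .h j => ⟨_, hh j⟩
    | .e j => ⟨_, he j⟩
    | .f j => ⟨_, hf j⟩
  have key : S.incl.comp (FreeLieAlgebra.lift K g) = proj (cartanJ A) := by
    apply FreeLieAlgebra.hom_ext
    rintro (j | j | j) <;> simp [g] <;> rfl
  refine eq_top_iff.2 fun x _ => ?_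
  obtain ⟨x, rfl⟩ : ∃ y, proj (cartanJ A) y = x := Submodule.Quotient.mk_surjective _ x
  rw [← key]
  exact (FreeLieAlgebra.lift K g x).2

/-- For `i ∉ J` the subspace `V'_i` is stable under `𝔤_J`. -/
theorem gJ_lie_mem {i : I} (hi : i ∉ J A) (x : gJ A) {v : BorcherdsAlgebra A}
    (hv : v ∈ VprimeI A i) : ⁅toBorcherds A x, v⁆ ∈ VprimeI A i := by
  have hf (j : J A) {v} (hv : v ∈ VprimeI A i) : ⁅f A j, v⁆ ∈ VprimeI A i := by
    rw [← toBorcherds_f]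
    exact nMinus_lie_mem A (LieSubalgebra.subset_lieSpan ⟨j, rfl⟩) hv
  have hh (j : J A) {v} (hv : v ∈ VprimeI A i) : ⁅h A j, v⁆ ∈ VprimeI A i := by
    have : VprimeI A i ≤ VprimeI A i ⊓
        (VprimeI A i).comap (LieAlgebra.ad K (BorcherdsAlgebra A) (h A j) :
          BorcherdsAlgebra A →ₗ[K] BorcherdsAlgebra A) := by
      refine VprimeI_le A _ ⟨f_mem_VprimeI A i, ?_⟩ fun k v hv => ⟨hf k hv.1, ?_⟩
      · simpa [lie_h_f] using (VprimeI A i).smul_mem _ (f_mem_VprimeI A i)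
      · have h2 : ⁅h A j, v⁆ ∈ VprimeI A i := hv.2
        show ⁅h A j, ⁅f A k, v⁆⁆ ∈ VprimeI A i
        rw [leibniz_lie, lie_h_f, neg_lie, smul_lie]
        exact (VprimeI A i).add_mem ((VprimeI A i).neg_mem
          ((VprimeI A i).smul_mem _ (hf k hv.1))) (hf k h2)
    exact (this hv).2
  have he (j : J A) {v} (hv : v ∈ VprimeI A i) : ⁅e A j, v⁆ ∈ VprimeI A i := by
    have : VprimeI A i ≤ VprimeI A i ⊓
        (VprimeI A i).comap (LieAlgebra.ad K (BorcherdsAlgebra A) (e A j)) := by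
      refine VprimeI_le A _ ⟨f_mem_VprimeI A i, ?_⟩ fun k v hv => ⟨hf k hv.1, ?_⟩
      · have : (j : I) ≠ i := fun h => hi (h ▸ j.2)
        simp [lie_e_f_ne A this]
      · have h2 : ⁅e A j, v⁆ ∈ VprimeI A i := hv.2
        show ⁅e A j, ⁅f A k, v⁆⁆ ∈ VprimeI A i
        rw [leibniz_lie]
        refine (VprimeI A i).add_mem ?_ (hf k h2)
        by_cases hjk : (j : I) = k
        · rw [← hjk, lie_e_f_self]; exact hh j hv.1
        · simp [lie_e_f_ne A hjk]
    exact (this hv).2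
  have : LieSubalgebra.lieSpan K (gJ A)
      (Set.range (e (cartanJ A)) ∪ Set.range (f (cartanJ A))) ≤ stab A (VprimeI A i) :=
    LieSubalgebra.lieSpan_le.2 (by
      rintro _ (⟨j, rfl⟩ | ⟨j, rfl⟩) v hv
      · rw [toBorcherds_e]; exact he j hv
      · rw [toBorcherds_f]; exact hf j hv)
  rw [closure_gJ] at this
  exact this (x := x) trivial v hv

/-- The index set `I ∖ J` of imaginary simple roots. -/
abbrev Im : Type _ := {i : I // i ∉ J A}

/-- The action of `𝔤_J` on `V'_i`, `i ∉ J`, by the adjoint action of `𝔤`. -/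
instance instLieRingModuleVprimeI (i : Im A) : LieRingModule (gJ A) (VprimeI A i.1) where
  bracket x v := ⟨⁅toBorcherds A x, v.1⁆, gJ_lie_mem A i.2 x v.2⟩
  add_lie x y v := Subtype.ext (by simp)
  lie_add x v w := Subtype.ext (by simp)
  leibniz_lie x y v := Subtype.ext (by simp)

instance instLieModuleVprimeI (i : Im A) : LieModule K (gJ A) (VprimeI A i.1) where
  smul_lie c x v := Subtype.ext (by
    change ⁅toBorcherds A (c • x), v.1⁆ = c • ⁅toBorcherds A x, v.1⁆
    simp)
  lie_smul c x v := Subtype.ext (by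
    change ⁅toBorcherds A x, c • v.1⁆ = c • ⁅toBorcherds A x, v.1⁆
    simp)

/-- The `𝔤_J`-module `V' = ∐ U(𝔫⁻_J) · f_i`, the sum being over `i ∈ I ∖ J`. -/
abbrev Vprime : Type _ := ⨁ i : Im A, VprimeI A i.1

/-- The homogeneous subspace of `V'` of degree `β ∈ Q`. -/
def VprimeGrade (β : I →₀ ℤ) : Submodule K (Vprime A) where
  carrier := {v | ∀ i : Im A, (v i : BorcherdsAlgebra A) ∈ rootSpace A β}
  add_mem' {v w} hv hw i := by
    rw [DirectSum.add_apply]; exact (rootSpace A β).add_mem (hv i) (hw i)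
  zero_mem' i := (rootSpace A β).zero_mem
  smul_mem' c v hv i := by
    rw [DirectSum.smul_apply]; exact (rootSpace A β).smul_mem c (hv i)

end Algebra

end Borcherds

/-! ### Lie algebras acting on tensor algebras -/

namespace TensorAlgebra

section Action

variable {R M : Type*} [CommRing R] [AddCommGroup M] [Module R M]

/-- The algebra homomorphism `t ↦ t + ε D(t)`, `ε ^ 2 = 0`, for the derivation `D` of the tensor
algebra that extends `φ`. -/
def dualHom (φ : Module.End R M) :
    TensorAlgebra R M →ₐ[R] TrivSqZeroExt (TensorAlgebra R M) (TensorAlgebra R M) :=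
  lift R
    { toFun := fun m => TrivSqZeroExt.inl (ι R m) + TrivSqZeroExt.inr (ι R (φ m))
      map_add' := fun m m' => by ext <;> simp
      map_smul' := fun r m => by ext <;> simp }

/-- The derivation of the tensor algebra that extends an endomorphism `φ` of `M`. -/
def der (φ : Module.End R M) : Module.End R (TensorAlgebra R M) where
  toFun t := (dualHom φ t).snd
  map_add' s t := by simp
  map_smul' r t := by simp

theorem der_ι (φ : Module.End R M) (m : M) : der φ (ι R m) = ι R (φ m) := by
  simp [der, dualHom]

theorem fst_dualHom (φ : Module.End R M) (t : TensorAlgebra R M) : (dualHom φ t).fst = t := by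
  have : (TrivSqZeroExt.fstHom R (TensorAlgebra R M) (TensorAlgebra R M)).comp (dualHom φ) =
      AlgHom.id R _ := by
    ext m
    simp [dualHom]
  exact DFunLike.congr_fun this t

theorem der_mul (φ : Module.End R M) (s t : TensorAlgebra R M) :
    der φ (s * t) = der φ s * t + s * der φ t := by
  have : (dualHom φ (s * t)).snd = (dualHom φ s).snd * t + s * (dualHom φ t).snd := by
    rw [map_mul, TrivSqZeroExt.snd_mul, fst_dualHom, fst_dualHom, add_comm]
    rfl
  exact this

theorem der_algebraMap (φ : Module.End R M) (r : R) :
    der φ (algebraMap R (TensorAlgebra R M) r) = 0 := by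
  have : (dualHom φ (algebraMap R _ r)).snd = 0 := by
    rw [AlgHom.commutes]; rfl
  exact this

variable {L : Type*} [LieRing L] [LieAlgebra R L] [LieRingModule L M] [LieModule R L M]

/-- The usual action of a Lie algebra on the tensor algebra of a module, by derivations:
`x · (m₁ ⊗ ⋯ ⊗ mₙ) = ∑ k, m₁ ⊗ ⋯ ⊗ (x · mₖ) ⊗ ⋯ ⊗ mₙ`. -/
instance instLieRingModule : LieRingModule L (TensorAlgebra R M) where
  bracket x t := der (LieModule.toEnd R L M x) t
  add_lie x y t := by
    induction t using TensorAlgebra.induction with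
    | algebraMap r => simp [der_algebraMap]
    | ι m => simp [der_ι]
    | mul s t hs ht =>
      simp only [der_mul] at hs ht ⊢
      rw [hs, ht, add_mul, mul_add]; abel
    | add s t hs ht =>
      rw [map_add (der _), hs, ht, map_add (der _), map_add (der _)]; abel
  lie_add x s t := map_add _ s t
  leibniz_lie x y t := by
    induction t using TensorAlgebra.induction with
    | algebraMap r => simp [der_algebraMap]
    | ι m =>
      simp only [der_ι, LieModule.toEnd_apply_apply]
      rw [leibniz_lie, map_add]
    | mul s t hs ht =>
      simp only [der_mul, map_add] at hs ht ⊢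
      rw [hs, ht, add_mul, mul_add]; abel
    | add s t hs ht =>
      simp only [map_add]
      rw [hs, ht]; abel

theorem lie_def (x : L) (t : TensorAlgebra R M) :
    ⁅x, t⁆ = der (LieModule.toEnd R L M x) t := rfl

instance instLieModule : LieModule R L (TensorAlgebra R M) where
  smul_lie c x t := by
    simp only [lie_def]
    induction t using TensorAlgebra.induction with
    | algebraMap r => simp [der_algebraMap]
    | ι m => simp [der_ι]
    | mul s t hs ht => simp only [der_mul, hs, ht]; simp
    | add s t hs ht => rw [map_add (der _), hs, ht, map_add (der _), smul_add]
  lie_smul c x t := map_smul _ c t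

/-- The grading of the tensor algebra by an additive monoid induced by a family `𝒱` of homogeneous
subspaces of `M`: the subspace of degree `β` is spanned by the products `m₁ ⊗ ⋯ ⊗ mₙ` with `mₖ`
homogeneous of degree `βₖ` and `β₁ + ⋯ + βₙ = β`. -/
def gradeOf {Q : Type*} [AddMonoid Q] (𝒱 : Q → Submodule R M) (β : Q) :
    Submodule R (TensorAlgebra R M) :=
  Submodule.span R {t | ∃ l : List (Q × M), (∀ p ∈ l, p.2 ∈ 𝒱 p.1) ∧
    (l.map Prod.fst).sum = β ∧ (l.map fun p => ι R p.2).prod = t}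

end Action

end TensorAlgebra

namespace Borcherds

variable {K : Subfield ℂ} {I : Type*} (A : Matrix I I K)

/-- The tensor algebra `T(V')`. -/
abbrev TVprime : Type _ := TensorAlgebra K (Vprime A)

/-- The homogeneous subspace of `T(V')` of degree `β ∈ Q`. -/
def TVprimeGrade (β : I →₀ ℤ) : Submodule K (TVprime A) :=
  TensorAlgebra.gradeOf (VprimeGrade A) β

end Borcherds

end

/-!
Everything rests on three observations about the generators.

*Degrees.* Rescaling `e_k` by `2 ^ δ_ik` and `f_k` by `2 ^ (-δ_ik)` respects the defining relations,
so it gives an endomorphism of `𝔤` (`Borcherds.degAut`) which acts on the homogeneous subspace of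
degree `β` as the scalar `2 ^ β_i`. It preserves each `V'_i` and hence extends to an algebra
endomorphism of `T(V')`. As `β` is determined by the numbers `2 ^ β_i`, the subspaces `T(V')_β` are
contained in simultaneous eigenspaces with distinct systems of eigenvalues, so their sum is direct
(`Borcherds.isInternal_TVprimeGrade`). That they span, and that every `T(V')_β` is
finite-dimensional, is seen on the spanning set of tensor products of words
`[f_{j₁}, [f_{j₂}, …, [f_{jₖ}, f_i]…]]`: such a product is homogeneous, its degree records how often
each generator occurs in it, and only finitely many products use each generator a given number of
times (`Borcherds.finite_tensorContent`).

*Weights.* `h_j` acts on `𝔤_β`, hence by the Leibniz rule on `T(V')_β`, as the scalar `β(h_j)`. So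
every nonzero `T(V')_β` lies in a weight space (`Borcherds.exists_le_weightSpace`) and `T(V')` is
the sum of its weight spaces, which is direct as a sum of simultaneous eigenspaces.

*Nilpotency.* For `j ∈ J` every `f_i` lies in the Engel subalgebras of `e_j` and of `f_j`: for `e_j`
because `ad e_j` maps `f_i` to `0` or `h_j`, for `f_j` by the Serre relation. Being subalgebras, these
contain `V'_i`, so `e_j` and `f_j` act locally nilpotently on `V'`, and by the Leibniz rule on `T(V')`
(`TensorAlgebra.exists_der_pow_eq_zero`).
-/

open scoped DirectSum

noncomputable section

/-! ### Simultaneous eigenspaces -/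

theorem Module.End.mem_maxGenEigenspace_zero {R M : Type*} [CommRing R] [AddCommGroup M]
    [Module R M] (φ : Module.End R M) (m : M) :
    m ∈ φ.maxGenEigenspace 0 ↔ ∃ n : ℕ, (φ ^ n) m = 0 := by
  simp

section JointEigenspaces

variable {F M ι κ : Type*} [Field F] [AddCommGroup M] [Module F M]

/-- A spanning family of simultaneous eigenspaces with pairwise distinct systems of eigenvalues is a
direct sum decomposition. The endomorphisms need not be assumed to commute: they do so because they
are simultaneously diagonal on a spanning family. -/
theorem DirectSum.isInternal_of_joint_eigenvectors [DecidableEq ι] (N : ι → Submodule F M)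
    (T : κ → Module.End F M) (χ : ι → κ → F) (hχ : Function.Injective χ)
    (hN : ∀ b k, ∀ x ∈ N b, T k x = χ b k • x) (htop : ⨆ b, N b = ⊤) :
    DirectSum.IsInternal N := by
  have comm (k l : κ) : Commute (T k) (T l) := by
    ext x
    have hx : x ∈ ⨆ b, N b := htop ▸ Submodule.mem_top
    induction hx using Submodule.iSup_induction' with
    | mem b x hx =>
      rw [Module.End.mul_apply, Module.End.mul_apply, hN b l x hx, map_smul, hN b k x hx, map_smul,
        hN b l x hx, smul_comm]
    | zero => simp
    | add x y _ _ hx hy => rw [map_add, map_add, hx, hy]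
  rw [DirectSum.isInternal_submodule_iff_iSupIndep_and_iSup_eq_top]
  refine ⟨?_, htop⟩
  have h := (Module.End.independent_iInf_maxGenEigenspace_of_forall_mapsTo T fun k l c =>
    Module.End.mapsTo_maxGenEigenspace_of_comm (comm l k) c).comp hχ
  refine h.mono fun b x hx => (Submodule.mem_iInf _).2 fun k => ?_
  exact (T k).mem_maxGenEigenspace (χ b k) x |>.2 ⟨1, by simp [hN b k x hx]⟩

end JointEigenspaces

/-! ### Derivations of the tensor algebra -/

namespace TensorAlgebra

variable {R M : Type*} [CommRing R] [AddCommGroup M] [Module R M]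

theorem der_pow_mul_eq_zero (φ : Module.End R M) (N : ℕ) :
    ∀ (m n : ℕ) (s t : TensorAlgebra R M), m + n = N → (der φ ^ m) s = 0 → (der φ ^ n) t = 0 →
      (der φ ^ N) (s * t) = 0 := by
  induction N with
  | zero =>
    intro m n s t hmn hs _
    obtain rfl : m = 0 := by omega
    have : s = 0 := by simpa using hs
    simp [this]
  | succ N ih =>
    intro m n s t hmn hs ht
    rcases m with _ | m
    · have : s = 0 := by simpa using hs
      simp [this]
    rcases n with _ | n
    · have : t = 0 := by simpa using ht
      simp [this]
    rw [pow_succ, Module.End.mul_apply, der_mul, map_add,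
      ih m (n + 1) _ _ (by omega) (by rwa [pow_succ, Module.End.mul_apply] at hs) ht,
      ih (m + 1) n _ _ (by omega) hs (by rwa [pow_succ, Module.End.mul_apply] at ht), add_zero]

/-- By the Leibniz rule, the derivation extending a locally nilpotent endomorphism is locally
nilpotent. -/
theorem exists_der_pow_eq_zero (φ : Module.End R M) (hφ : ∀ m, ∃ n : ℕ, (φ ^ n) m = 0)
    (t : TensorAlgebra R M) : ∃ n : ℕ, (der φ ^ n) t = 0 := by
  induction t using TensorAlgebra.induction with
  | algebraMap r => exact ⟨1, by simp [der_algebraMap]⟩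
  | ι m =>
    obtain ⟨n, hn⟩ := hφ m
    have h (k : ℕ) : (der φ ^ k) (ι R m) = ι R ((φ ^ k) m) := by
      induction k with
      | zero => simp
      | succ k ih => rw [pow_succ', pow_succ', Module.End.mul_apply, ih, der_ι]; rfl
    exact ⟨n, by rw [h, hn, map_zero]⟩
  | mul s t hs ht =>
    obtain ⟨m, hm⟩ := hs
    obtain ⟨n, hn⟩ := ht
    exact ⟨m + n, der_pow_mul_eq_zero φ _ m n s t rfl hm hn⟩
  | add s t hs ht =>
    rw [← Module.End.mem_maxGenEigenspace_zero] at *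
    exact add_mem hs ht

section Grading

variable {Q : Type*} (𝒱 : Q → Submodule R M)

theorem ι_mem_gradeOf [AddMonoid Q] {β : Q} {m : M} (hm : m ∈ 𝒱 β) :
    ι R m ∈ gradeOf 𝒱 β :=
  Submodule.subset_span ⟨[(β, m)], by simpa using hm, by simp, by simp⟩

theorem gradedMonoid_gradeOf [AddMonoid Q] : SetLike.GradedMonoid (gradeOf 𝒱) where
  one_mem := Submodule.subset_span ⟨[], by simp, by simp, by simp⟩
  mul_mem β γ s t hs ht := by
    have h := Submodule.mul_mem_mul hs ht
    rw [gradeOf, gradeOf, Submodule.span_mul_span] at h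
    refine Submodule.span_mono ?_ h
    rintro _ ⟨_, ⟨l, hl, rfl, rfl⟩, _, ⟨l', hl', rfl, rfl⟩, rfl⟩
    refine ⟨l ++ l', fun p hp => ?_, by simp, by simp⟩
    rcases List.mem_append.1 hp with hp | hp
    exacts [hl p hp, hl' p hp]

/-- A property of homogeneous elements of the tensor algebra may be checked on scalars and on
products `ι m * t`, `m` and `t` homogeneous. -/
theorem gradeOf_le [AddMonoid Q] (N : Q → Submodule R (TensorAlgebra R M)) (one : 1 ∈ N 0)
    (mul : ∀ β γ, ∀ m ∈ 𝒱 β, ∀ t ∈ gradeOf 𝒱 γ, t ∈ N γ → ι R m * t ∈ N (β + γ)) (β : Q) :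
    gradeOf 𝒱 β ≤ N β := by
  refine Submodule.span_le.2 ?_
  rintro _ ⟨l, hl, rfl, rfl⟩
  induction l with
  | nil => simpa using one
  | cons p l ih =>
    have hl' : ∀ p ∈ l, p.2 ∈ 𝒱 p.1 := fun q hq => hl q (List.mem_cons_of_mem _ hq)
    simpa using mul p.1 _ p.2 (hl p List.mem_cons_self) _
      (Submodule.subset_span ⟨l, hl', rfl, rfl⟩) (ih hl')

/-- A derivation that extends a homogeneous endomorphism of degree `α` is homogeneous of
degree `α`. -/
theorem der_mem_gradeOf [AddCommMonoid Q] (φ : Module.End R M) (α : Q)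
    (hφ : ∀ β, ∀ m ∈ 𝒱 β, φ m ∈ 𝒱 (α + β)) {β : Q} {t : TensorAlgebra R M}
    (ht : t ∈ gradeOf 𝒱 β) : der φ t ∈ gradeOf 𝒱 (α + β) := by
  have := gradedMonoid_gradeOf 𝒱
  refine gradeOf_le 𝒱 (fun β => (gradeOf 𝒱 (α + β)).comap (der φ)) ?_ ?_ β ht
  · have h := der_algebraMap (M := M) φ (1 : R)
    rw [map_one] at h
    rw [Submodule.mem_comap, h]
    exact zero_mem _
  · intro β γ m hm t ht htN
    rw [Submodule.mem_comap, der_mul, der_ι]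
    refine add_mem ?_ ?_
    · rw [← add_assoc]
      exact SetLike.mul_mem_graded (ι_mem_gradeOf 𝒱 (hφ β m hm)) ht
    · rw [add_left_comm]
      exact SetLike.mul_mem_graded (ι_mem_gradeOf 𝒱 hm) htN

/-- If `φ` acts on the homogeneous subspaces by scalars depending additively on the degree, so does
the derivation that extends it. -/
theorem der_eq_smul [AddMonoid Q] (φ : Module.End R M) (c : Q →+ R)
    (hφ : ∀ β, ∀ m ∈ 𝒱 β, φ m = c β • m) {β : Q} {t : TensorAlgebra R M}
    (ht : t ∈ gradeOf 𝒱 β) : der φ t = c β • t := by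
  refine gradeOf_le 𝒱 (fun β => LinearMap.eqLocus (der φ) (c β • LinearMap.id)) ?_ ?_ β ht
  · have h := der_algebraMap (M := M) φ (1 : R)
    rw [map_one] at h
    rw [LinearMap.mem_eqLocus, h, map_zero, zero_smul, LinearMap.zero_apply]
  · intro β γ m hm t _ htN
    have htN : der φ t = c γ • t := htN
    rw [LinearMap.mem_eqLocus, der_mul, der_ι, hφ β m hm, htN, map_add, add_smul, map_smul,
      smul_mul_assoc, mul_smul_comm]
    rfl

/-- If `φ` acts on the homogeneous subspaces by scalars depending multiplicatively on the degree, so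
does the algebra endomorphism that extends it. -/
theorem lift_eq_smul [AddMonoid Q] (φ : Module.End R M) (c : Multiplicative Q →* R)
    (hφ : ∀ β, ∀ m ∈ 𝒱 β, φ m = c (.ofAdd β) • m) {β : Q} {t : TensorAlgebra R M}
    (ht : t ∈ gradeOf 𝒱 β) : lift R (ι R ∘ₗ φ) t = c (.ofAdd β) • t := by
  refine gradeOf_le 𝒱 (fun β => LinearMap.eqLocus (lift R (ι R ∘ₗ φ)).toLinearMap
    (c (.ofAdd β) • LinearMap.id)) ?_ ?_ β ht
  · simp
  · intro β γ m hm t _ htN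
    have htN : lift R (ι R ∘ₗ φ) t = c (.ofAdd γ) • t := htN
    rw [LinearMap.mem_eqLocus, AlgHom.toLinearMap_apply, map_mul, htN, lift_ι_apply,
      LinearMap.comp_apply, hφ β m hm]
    simp [smul_smul, mul_comm]

end Grading

end TensorAlgebra

namespace Borcherds

variable {K : Subfield ℂ} {I : Type*} (A : Matrix I I K)

/-! ### The root lattice grading of the Borcherds algebra -/

theorem lie_mem_rootSpace {α β : I →₀ ℤ} {x y : BorcherdsAlgebra A} (hx : x ∈ rootSpace A α)
    (hy : y ∈ rootSpace A β) : ⁅x, y⁆ ∈ rootSpace A (α + β) := by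
  induction hx using Submodule.span_induction with
  | zero => simp
  | add x x' _ _ hx hx' => rw [add_lie]; exact add_mem hx hx'
  | smul c x _ hx => rw [smul_lie]; exact Submodule.smul_mem _ c hx
  | mem x hx =>
    induction hy using Submodule.span_induction with
    | zero => simp
    | add y y' _ _ hy hy' => rw [lie_add]; exact add_mem hy hy'
    | smul c y _ hy => rw [lie_smul]; exact Submodule.smul_mem _ c hy
    | mem y hy => exact Submodule.subset_span (.lie hx hy)

theorem f_mem_rootSpace (i : I) : f A i ∈ rootSpace A (-Finsupp.single i 1) :=
  Submodule.subset_span (.f i)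

theorem toBorcherds_mem_rootSpace {α : J A →₀ ℤ} {x : gJ A} (hx : x ∈ rootSpace (cartanJ A) α) :
    toBorcherds A x ∈ rootSpace A (α.mapDomain Subtype.val) := by
  induction hx using Submodule.span_induction with
  | zero => simp
  | add x y _ _ hx hy => rw [map_add]; exact add_mem hx hy
  | smul c x _ hx => rw [map_smul]; exact Submodule.smul_mem _ c hx
  | mem x hx =>
    induction hx with
    | h i =>
      rw [Finsupp.mapDomain_zero, toBorcherds_h]
      exact Submodule.subset_span (.h i.1)
    | e i =>
      rw [Finsupp.mapDomain_single, toBorcherds_e]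
      exact Submodule.subset_span (.e i.1)
    | f i =>
      have h : (-Finsupp.single i (1 : ℤ)).mapDomain Subtype.val = -Finsupp.single i.1 1 := by
        rw [← Finsupp.single_neg, ← Finsupp.single_neg, Finsupp.mapDomain_single]
      rw [h, toBorcherds_f]
      exact f_mem_rootSpace A i.1
    | lie _ _ hx hy =>
      rw [Finsupp.mapDomain_add, LieHom.map_lie]
      exact lie_mem_rootSpace A hx hy

/-- The value `β(h_i)`, additive in `β ∈ Q`. -/
def evalCoroot (i : I) : (I →₀ ℤ) →+ K :=
  Finsupp.liftAddHom fun k => (AddMonoidHom.mulRight (A i k)).comp (Int.castAddHom K)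

theorem evalCoroot_apply (i : I) (β : I →₀ ℤ) :
    evalCoroot A i β = β.sum fun k n => (n : K) * A i k := rfl

@[simp] theorem evalCoroot_single (i k : I) :
    evalCoroot A i (Finsupp.single k 1) = A i k := by
  simp [evalCoroot_apply]

theorem lie_h_eq_smul (i : I) {β : I →₀ ℤ} {x : BorcherdsAlgebra A} (hx : x ∈ rootSpace A β) :
    ⁅h A i, x⁆ = evalCoroot A i β • x := by
  induction hx using Submodule.span_induction with
  | zero => simp
  | add x y _ _ hx hy => rw [lie_add, hx, hy, smul_add]
  | smul c x _ hx => rw [lie_smul, hx, smul_comm]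
  | mem x hx =>
    induction hx with
    | h k => simp [lie_h_h]
    | e k => simp [lie_h_e]
    | f k => simp [lie_h_f]
    | lie _ _ hx hy => rw [leibniz_lie, hx, hy, map_add]; simp [add_smul]

/-- The character `β ↦ 2 ^ β_i` of the root lattice. -/
def degChar (i : I) : Multiplicative (I →₀ ℤ) →* K where
  toFun β := (2 : K) ^ (β.toAdd i)
  map_one' := by simp
  map_mul' β γ := by simp [zpow_add₀]

/-- The images `h_k`, `2 ^ δ_ik e_k`, `2 ^ (-δ_ik) f_k` of the generators under `degAut`. -/
def genDeg (i : I) : Gen I → BorcherdsAlgebra A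
  | .h k => h A k
  | .e k => degChar (K := K) i (.ofAdd (Finsupp.single k 1)) • e A k
  | .f k => degChar (K := K) i (.ofAdd (-Finsupp.single k 1)) • f A k

theorem ad_smul_pow_smul {L : Type*} [LieRing L] [LieAlgebra K L] (c d : K) (x y : L) (n : ℕ) :
    (LieAlgebra.ad K L (c • x) ^ n) (d • y) = (c ^ n * d) • (LieAlgebra.ad K L x ^ n) y := by
  rw [map_smul (LieAlgebra.ad K L), smul_pow, LinearMap.smul_apply, map_smul, smul_smul]

/-- The endomorphism of `𝔤` that acts on the homogeneous subspace of degree `β` as the scalar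
`2 ^ β_i`. As `2` is not a root of unity, these endomorphisms detect the degree. -/
def degAut (i : I) : BorcherdsAlgebra A →ₗ⁅K⁆ BorcherdsAlgebra A :=
  lift A (FreeLieAlgebra.lift K (genDeg A i)) (by
    intro x hx
    cases hx with
    | hh j k => simp [genDeg, lie_h_h]
    | he j k => simp [genDeg, lie_h_e, smul_comm (A j k)]
    | hf j k => simp [genDeg, lie_h_f, smul_comm (A j k)]
    | ef_self j =>
      have h : degChar (K := K) i (.ofAdd (Finsupp.single j 1)) *
          degChar i (.ofAdd (-Finsupp.single j 1)) = 1 := by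
        rw [← map_mul, ← ofAdd_add, add_neg_cancel, ofAdd_zero, map_one]
      rw [map_sub, LieHom.map_lie, FreeLieAlgebra.lift_of_apply, FreeLieAlgebra.lift_of_apply,
        FreeLieAlgebra.lift_of_apply, genDeg, genDeg, genDeg, smul_lie, lie_smul, lie_e_f_self,
        smul_smul, h, one_smul, sub_self]
    | ef_ne j k hjk => simp [genDeg, lie_e_f_ne A hjk]
    | serre_e j k n hjk hj hn =>
      have := proj_relator A (.serre_e j k n hjk hj hn)
      rw [map_ad_pow] at this
      rw [map_ad_pow, FreeLieAlgebra.lift_of_apply, FreeLieAlgebra.lift_of_apply, genDeg, genDeg,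
        ad_smul_pow_smul, e, e, this, smul_zero]
    | serre_f j k n hjk hj hn =>
      have := proj_relator A (.serre_f j k n hjk hj hn)
      rw [map_ad_pow] at this
      rw [map_ad_pow, FreeLieAlgebra.lift_of_apply, FreeLieAlgebra.lift_of_apply, genDeg, genDeg,
        ad_smul_pow_smul, f, f, this, smul_zero]
    | ee j k hjk =>
      have := proj_relator A (.ee j k hjk)
      rw [LieHom.map_lie] at this
      rw [LieHom.map_lie, FreeLieAlgebra.lift_of_apply, FreeLieAlgebra.lift_of_apply, genDeg,
        genDeg, smul_lie, lie_smul, e, e, this, smul_zero, smul_zero]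
    | ff j k hjk =>
      have := proj_relator A (.ff j k hjk)
      rw [LieHom.map_lie] at this
      rw [LieHom.map_lie, FreeLieAlgebra.lift_of_apply, FreeLieAlgebra.lift_of_apply, genDeg,
        genDeg, smul_lie, lie_smul, f, f, this, smul_zero, smul_zero])

theorem degAut_eq_smul (i : I) {β : I →₀ ℤ} {x : BorcherdsAlgebra A} (hx : x ∈ rootSpace A β) :
    degAut A i x = degChar (K := K) i (.ofAdd β) • x := by
  induction hx using Submodule.span_induction with
  | zero => simp
  | add x y _ _ hx hy => rw [map_add, hx, hy, smul_add]
  | smul c x _ hx => rw [map_smul, hx, smul_comm]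
  | mem x hx =>
    induction hx with
    | h k => simp [degAut, h, lift_proj, genDeg]
    | e k => simp [degAut, e, lift_proj, genDeg]
    | f k => simp [degAut, f, lift_proj, genDeg]
    | lie _ _ hx hy =>
      rw [LieHom.map_lie, hx, hy, ofAdd_add, map_mul]
      simp [smul_smul, mul_comm]

/-! ### Local nilpotency of the real Chevalley generators -/

/-- The exponents in the Serre relations are natural numbers. -/
theorem exists_natCast_eq (hA : IsBorcherdsMatrix A) {i j : I} (hi : i ∈ J A) (hij : i ≠ j) :
    ∃ n : ℕ, (n : K) = -2 * A i j / A i i := by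
  have hi : 0 < (A i i : ℂ).re := hi
  obtain ⟨m, hm⟩ := hA.integral i hi j
  have h0 : A i i ≠ 0 := fun h => by simp [h] at hi
  have h1 : (2 * A i j : ℂ) = m * A i i := by
    have := (div_eq_iff h0).1 hm
    rw [two_mul] at this ⊢
    simpa using congrArg K.subtype this
  have h2 : 2 * (A i j : ℂ).re = m * (A i i : ℂ).re := by
    simpa using congrArg Complex.re h1
  have h3 := hA.nonpos i j hij
  have h4 : m ≤ 0 := by
    by_contra! h
    have : (0 : ℝ) < m := by exact_mod_cast h
    nlinarith [mul_pos this hi]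
  refine ⟨(-m).toNat, ?_⟩
  rw [neg_mul, neg_div, hm, ← Int.cast_natCast, Int.toNat_of_nonneg (by omega), Int.cast_neg]

/-- The Engel subalgebra of `e_j` contains all `f_k`: for `k = j` because of
`ad e_j : f_j ↦ h_j ↦ -a_jj e_j ↦ 0`. -/
theorem VprimeI_le_engel_e (j : J A) (i : I) :
    VprimeI A i ≤ (LieSubalgebra.engel K (e A j)).toSubmodule := by
  have hf (k : I) : f A k ∈ LieSubalgebra.engel K (e A j) := by
    rw [LieSubalgebra.mem_engel_iff]
    by_cases h : (j : I) = k
    · subst h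
      refine ⟨3, ?_⟩
      have : ⁅e A j, h A j⁆ = -(A j j • e A (j : I)) := by rw [← lie_skew, lie_h_e]
      simp [pow_succ, lie_e_f_self, this]
    · exact ⟨1, by simp [lie_e_f_ne A h]⟩
  exact VprimeI_le A _ (hf i) fun k v hv => LieSubalgebra.lie_mem _ (hf k) hv

/-- The Engel subalgebra of `f_j` contains all `f_k`, by the Serre relations. -/
theorem VprimeI_le_engel_f (hA : IsBorcherdsMatrix A) (j : J A) (i : I) :
    VprimeI A i ≤ (LieSubalgebra.engel K (f A j)).toSubmodule := by
  have hf (k : I) : f A k ∈ LieSubalgebra.engel K (f A j) := by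
    rw [LieSubalgebra.mem_engel_iff]
    by_cases h : (j : I) = k
    · exact ⟨1, by simp [← h]⟩
    · obtain ⟨n, hn⟩ := exists_natCast_eq A hA j.2 h
      have := proj_relator A (.serre_f j.1 k n h j.2 hn)
      rw [map_ad_pow] at this
      exact ⟨n + 1, this⟩
  exact VprimeI_le A _ (hf i) fun k v hv => LieSubalgebra.lie_mem _ (hf k) hv

theorem coe_toEnd_pow_VprimeI (i : Im A) (x : gJ A) (n : ℕ) (v : VprimeI A i.1) :
    ((LieModule.toEnd K (gJ A) (VprimeI A i.1) x ^ n) v : BorcherdsAlgebra A) =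
      (LieAlgebra.ad K (BorcherdsAlgebra A) (toBorcherds A x) ^ n) v := by
  induction n with
  | zero => simp
  | succ n ih => rw [pow_succ', pow_succ', Module.End.mul_apply, Module.End.mul_apply, ← ih]; rfl

theorem lieModuleOf_toEnd_pow [DecidableEq (Im A)] (i : Im A) (x : gJ A) (n : ℕ)
    (v : VprimeI A i.1) :
    (LieModule.toEnd K (gJ A) (Vprime A) x ^ n)
        (DirectSum.lieModuleOf K _ (gJ A) (fun i : Im A => VprimeI A i.1) i v) =
      DirectSum.lieModuleOf K _ (gJ A) (fun i : Im A => VprimeI A i.1) i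
        ((LieModule.toEnd K (gJ A) (VprimeI A i.1) x ^ n) v) := by
  induction n with
  | zero => simp
  | succ n ih =>
    rw [pow_succ', pow_succ', Module.End.mul_apply, Module.End.mul_apply, ih]
    simp

theorem exists_toEnd_Vprime_pow_eq_zero (x : gJ A)
    (hx : ∀ i : Im A, VprimeI A i.1 ≤ (LieSubalgebra.engel K (toBorcherds A x)).toSubmodule)
    (v : Vprime A) : ∃ n : ℕ, (LieModule.toEnd K (gJ A) (Vprime A) x ^ n) v = 0 := by
  classical
  induction v using DirectSum.induction_on with
  | zero => exact ⟨0, by simp⟩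
  | of i v =>
    obtain ⟨n, hn⟩ := (LieSubalgebra.mem_engel_iff K _ _).1 (hx i v.2)
    refine ⟨n, (lieModuleOf_toEnd_pow A i x n v).trans ?_⟩
    rw [show (LieModule.toEnd K (gJ A) (VprimeI A i.1) x ^ n) v = 0 from
      Subtype.ext ((coe_toEnd_pow_VprimeI A i x n v).trans hn), map_zero]
  | add v w hv hw =>
    rw [← Module.End.mem_maxGenEigenspace_zero] at *
    exact add_mem hv hw

theorem exists_toEnd_TVprime_pow_eq_zero (x : gJ A)
    (hx : ∀ i : Im A, VprimeI A i.1 ≤ (LieSubalgebra.engel K (toBorcherds A x)).toSubmodule)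
    (t : TVprime A) : ∃ n : ℕ, (LieModule.toEnd K (gJ A) (TVprime A) x ^ n) t = 0 :=
  TensorAlgebra.exists_der_pow_eq_zero _ (exists_toEnd_Vprime_pow_eq_zero A x hx) t

/-! ### Words -/

/-- The degree in `Q` of a bracket of the generators `f_i`, `i` running through the multiset `m`. -/
def negDeg (m : Multiset I) : I →₀ ℤ := -(m.map fun i => Finsupp.single i (1 : ℤ)).sum

theorem negDeg_add (m m' : Multiset I) : negDeg (m + m') = negDeg m + negDeg m' := by
  simp [negDeg, add_comm]

theorem negDeg_cons (i : I) (m : Multiset I) :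
    negDeg (i ::ₘ m) = -Finsupp.single i 1 + negDeg m := by
  simp [negDeg, add_comm]

theorem negDeg_apply [DecidableEq I] (m : Multiset I) (i : I) : negDeg m i = -(m.count i : ℤ) := by
  induction m using Multiset.induction_on with
  | empty => simp [negDeg]
  | cons j m ih =>
    rw [negDeg_cons, Finsupp.add_apply, ih, Multiset.count_cons, Finsupp.neg_apply,
      Finsupp.single_apply]
    by_cases h : i = j <;> simp [h, eq_comm, add_comm]

theorem negDeg_injective : Function.Injective (negDeg : Multiset I → I →₀ ℤ) := by
  classical
  intro m m' h
  ext i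
  simpa [negDeg_apply] using DFunLike.congr_fun h i

/-- The element `[f_{j₁}, [f_{j₂}, …, [f_{jₖ}, f_i]…]]` of `V'_i`, for `l = [j₁, …, jₖ]`. -/
def word (i : Im A) : List (J A) → VprimeI A i.1
  | [] => ⟨f A i, f_mem_VprimeI A i⟩
  | j :: l => ⁅f (cartanJ A) j, word i l⁆

/-- The indices of the generators that occur in `word A p.1 p.2`, with multiplicities. -/
def wordContent (p : Im A × List (J A)) : Multiset I :=
  p.1.1 ::ₘ (p.2.map Subtype.val : Multiset I)

theorem coe_word_cons (i : Im A) (j : J A) (l : List (J A)) :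
    (word A i (j :: l) : BorcherdsAlgebra A) = ⁅f A j, (word A i l : BorcherdsAlgebra A)⁆ := by
  rw [← toBorcherds_f]; rfl

theorem word_mem_rootSpace (i : Im A) (l : List (J A)) :
    (word A i l : BorcherdsAlgebra A) ∈ rootSpace A (negDeg (wordContent A (i, l))) := by
  induction l with
  | nil => simpa [word, wordContent, negDeg] using f_mem_rootSpace A i.1
  | cons j l ih =>
    have h : negDeg (wordContent A (i, j :: l)) =
        -Finsupp.single j.1 1 + negDeg (wordContent A (i, l)) := by
      rw [← negDeg_cons]
      congr 1
      exact Multiset.cons_swap i.1 j.1 (l.map Subtype.val : Multiset I)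
    rw [coe_word_cons, h]
    exact lie_mem_rootSpace A (f_mem_rootSpace A _) ih

theorem span_range_word (i : Im A) : Submodule.span K (Set.range (word A i)) = ⊤ := by
  refine Submodule.map_injective_of_injective (VprimeI A i.1).injective_subtype
    (le_antisymm (Submodule.map_mono le_top) ?_)
  rw [Submodule.map_subtype_top]
  refine VprimeI_le A _ ⟨word A i [], Submodule.subset_span ⟨[], rfl⟩, rfl⟩ ?_
  rintro j _ ⟨v, hv, rfl⟩
  induction hv using Submodule.span_induction with
  | zero => simp
  | add v w _ _ hv hw => rw [map_add, lie_add]; exact add_mem hv hw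
  | smul c v _ hv => rw [map_smul, lie_smul]; exact Submodule.smul_mem _ c hv
  | mem v hv =>
    obtain ⟨l, rfl⟩ := hv
    exact ⟨word A i (j :: l), Submodule.subset_span ⟨_, rfl⟩, coe_word_cons A i j l⟩

open scoped Classical in
/-- `word A p.1 p.2` as an element of `V'`. -/
def wordV (p : Im A × List (J A)) : Vprime A :=
  DirectSum.lof K (Im A) (fun i => VprimeI A i.1) p.1 (word A p.1 p.2)

theorem span_range_wordV : Submodule.span K (Set.range (wordV A)) = ⊤ := by
  classical
  refine eq_top_iff.2 fun v _ => ?_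
  induction v using DirectSum.induction_on with
  | zero => exact zero_mem _
  | add v w hv hw => exact add_mem (hv trivial) (hw trivial)
  | of i v =>
    have hv : v ∈ Submodule.span K (Set.range (word A i)) := by
      rw [span_range_word]; exact Submodule.mem_top
    have := Submodule.mem_map_of_mem
      (f := DirectSum.lof K (Im A) (fun i => VprimeI A i.1) i) hv
    rw [Submodule.map_span] at this
    refine Submodule.span_mono ?_ this
    rintro _ ⟨_, ⟨l, rfl⟩, rfl⟩
    refine ⟨(i, l), ?_⟩
    rw [wordV]

theorem wordV_mem (p : Im A × List (J A)) :
    wordV A p ∈ VprimeGrade A (negDeg (wordContent A p)) := by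
  classical
  intro i
  rw [wordV, DirectSum.lof_eq_of]
  by_cases h : p.1 = i
  · subst h
    rw [DirectSum.of_eq_same]
    exact word_mem_rootSpace A p.1 p.2
  · rw [DirectSum.of_eq_of_ne _ _ _ (Ne.symm h)]
    exact zero_mem _

/-- The tensor product of a list of words. -/
def tensorWord (l : List (Im A × List (J A))) : TVprime A :=
  (l.map fun p => TensorAlgebra.ι K (wordV A p)).prod

/-- The indices of the generators that occur in `tensorWord A l`, with multiplicities. -/
def tensorContent (l : List (Im A × List (J A))) : Multiset I := (l.map (wordContent A)).sum

theorem tensorWord_mem (l : List (Im A × List (J A))) :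
    tensorWord A l ∈ TVprimeGrade A (negDeg (tensorContent A l)) := by
  refine Submodule.subset_span
    ⟨l.map fun p => (negDeg (wordContent A p), wordV A p), ?_, ?_, ?_⟩
  · simp only [List.mem_map]
    rintro _ ⟨p, _, rfl⟩
    exact wordV_mem A p
  · induction l with
    | nil => simp [tensorContent, negDeg]
    | cons p l ih =>
      rw [List.map_cons, List.map_cons, List.sum_cons, ih, ← negDeg_add]
      simp [tensorContent]
  · simp [tensorWord, Function.comp_def]

theorem span_range_tensorWord : Submodule.span K (Set.range (tensorWord A)) = ⊤ := by
  refine eq_top_iff.2 fun t _ => ?_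
  induction t using TensorAlgebra.induction with
  | algebraMap r =>
    rw [Algebra.algebraMap_eq_smul_one]
    exact Submodule.smul_mem _ r (Submodule.subset_span ⟨[], rfl⟩)
  | ι v =>
    have hv : v ∈ Submodule.span K (Set.range (wordV A)) := by
      rw [span_range_wordV]; exact Submodule.mem_top
    have := Submodule.mem_map_of_mem (f := TensorAlgebra.ι K) hv
    rw [Submodule.map_span] at this
    refine Submodule.span_mono ?_ this
    rintro _ ⟨_, ⟨p, rfl⟩, rfl⟩
    exact ⟨[p], by simp [tensorWord]⟩
  | mul s t hs ht =>
    have := Submodule.mul_mem_mul (hs trivial) (ht trivial)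
    rw [Submodule.span_mul_span] at this
    refine Submodule.span_mono ?_ this
    rintro _ ⟨_, ⟨l, rfl⟩, _, ⟨l', rfl⟩, rfl⟩
    exact ⟨l ++ l', by simp [tensorWord]⟩
  | add s t hs ht => exact add_mem (hs trivial) (ht trivial)

theorem _root_.List.finite_setOf_length_le_of_forall_mem {α : Type*} {s : Set α} (hs : s.Finite)
    (n : ℕ) : {l : List α | l.length ≤ n ∧ ∀ x ∈ l, x ∈ s}.Finite := by
  have : Finite s := hs
  refine ((List.finite_length_le s n).image (List.map Subtype.val)).subset ?_
  rintro l ⟨hl, hls⟩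
  lift l to List s using hls
  exact ⟨l, by simpa using hl, rfl⟩

/-- Only finitely many tensor products of words have a given content: the content bounds their
lengths and the indices that occur in them. -/
theorem finite_tensorContent (m : Multiset I) :
    {l : List (Im A × List (J A)) | tensorContent A l = m}.Finite := by
  have hle {l : List (Im A × List (J A))} {p} (hp : p ∈ l) :
      wordContent A p ≤ tensorContent A l :=
    List.single_le_sum (fun _ _ => Multiset.zero_le _) _ (List.mem_map_of_mem hp)
  have hfin : {i | i ∈ m}.Finite := by
    classical
    exact m.toFinset.finite_toSet.subset fun i hi => by simpa using hi
  have hletters : {p : Im A × List (J A) | wordContent A p ≤ m}.Finite := by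
    refine ((hfin.preimage (Subtype.val_injective.injOn (s := _))).prod
      (List.finite_setOf_length_le_of_forall_mem
        (hfin.preimage (Subtype.val_injective.injOn (s := _))) (Multiset.card m))).subset ?_
    rintro ⟨i, l⟩ h
    have h : wordContent A (i, l) ≤ m := h
    have hi : i.1 ∈ m := Multiset.mem_of_le h (by simp [wordContent])
    have hl (j : J A) (hj : j ∈ l) : j.1 ∈ m := Multiset.mem_of_le h (by simp [wordContent, hj])
    refine ⟨hi, ?_, hl⟩
    have := Multiset.card_le_card h
    rw [wordContent, Multiset.card_cons, Multiset.coe_card, List.length_map] at this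
    exact (Nat.le_succ _).trans this
  refine (List.finite_setOf_length_le_of_forall_mem hletters (Multiset.card m)).subset ?_
  rintro l rfl
  refine ⟨?_, fun p hp => hle hp⟩
  have hcard : ∀ l : List (Im A × List (J A)), l.length ≤ Multiset.card (tensorContent A l) := by
    intro l
    induction l with
    | nil => simp
    | cons p l ih =>
      simp only [tensorContent, List.map_cons, List.sum_cons, Multiset.card_add] at ih ⊢
      simp only [wordContent, Multiset.card_cons, List.length_cons]
      omega
  exact hcard l

/-! ### The grading of the tensor algebra -/

theorem iSup_TVprimeGrade : ⨆ β, TVprimeGrade A β = ⊤ := by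
  rw [eq_top_iff, ← span_range_tensorWord, Submodule.span_le]
  rintro _ ⟨l, rfl⟩
  exact Submodule.mem_iSup_of_mem _ (tensorWord_mem A l)

theorem degAut_mem_VprimeI (k i : I) {v : BorcherdsAlgebra A} (hv : v ∈ VprimeI A i) :
    degAut A k v ∈ VprimeI A i := by
  have : VprimeI A i ≤ (VprimeI A i).comap (degAut A k : BorcherdsAlgebra A →ₗ[K] _) := by
    refine VprimeI_le A _ ?_ fun j v hv => ?_
    · show degAut A k (f A i) ∈ VprimeI A i
      rw [degAut_eq_smul A k (f_mem_rootSpace A i)]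
      exact Submodule.smul_mem _ _ (f_mem_VprimeI A i)
    · show degAut A k ⁅f A j, v⁆ ∈ VprimeI A i
      rw [LieHom.map_lie, degAut_eq_smul A k (f_mem_rootSpace A j), smul_lie, ← toBorcherds_f]
      exact Submodule.smul_mem _ _
        (nMinus_lie_mem A (LieSubalgebra.subset_lieSpan ⟨j, rfl⟩) hv)
  exact this hv

/-- The endomorphism of `V'` induced by `degAut`. -/
def degEnd (k : I) : Module.End K (Vprime A) :=
  DFinsupp.mapRange.linearMap fun i : Im A =>
    (degAut A k : BorcherdsAlgebra A →ₗ[K] BorcherdsAlgebra A).restrict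
      (p := VprimeI A i.1) (q := VprimeI A i.1) fun _ hv => degAut_mem_VprimeI A k i.1 hv

theorem degEnd_eq_smul (k : I) {β : I →₀ ℤ} {v : Vprime A} (hv : v ∈ VprimeGrade A β) :
    degEnd A k v = degChar (K := K) k (.ofAdd β) • v := by
  refine DFinsupp.ext fun i => Subtype.ext ?_
  exact degAut_eq_smul A k (hv i)

theorem isInternal_TVprimeGrade [DecidableEq (I →₀ ℤ)] :
    DirectSum.IsInternal (TVprimeGrade A) := by
  refine DirectSum.isInternal_of_joint_eigenvectors (TVprimeGrade A)
    (fun k => (TensorAlgebra.lift K (TensorAlgebra.ι K ∘ₗ degEnd A k)).toLinearMap)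
    (fun β k => degChar (K := K) k (.ofAdd β)) (fun β γ h => ?_)
    (fun β k t ht => TensorAlgebra.lift_eq_smul (VprimeGrade A) (degEnd A k) (degChar k)
      (fun β v hv => degEnd_eq_smul A k hv) ht) (iSup_TVprimeGrade A)
  ext k
  have h : (2 : K) ^ β k = 2 ^ γ k := congrFun h k
  -- compare the powers of `2` in `ℚ`, where `n ↦ 2 ^ n` is strictly monotone
  have h : ((2 : ℚ) : K) ^ β k = ((2 : ℚ) : K) ^ γ k := by simpa using h
  exact zpow_right_injective₀ (a := (2 : ℚ)) (by norm_num) (by norm_num) (by exact_mod_cast h)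

theorem finiteDimensional_TVprimeGrade (β : I →₀ ℤ) : FiniteDimensional K (TVprimeGrade A β) := by
  classical
  let S (β : I →₀ ℤ) : Submodule K (TVprime A) :=
    Submodule.span K (tensorWord A '' {l | negDeg (tensorContent A l) = β})
  have hS : S ≤ TVprimeGrade A := by
    intro γ
    refine Submodule.span_le.2 ?_
    rintro _ ⟨l, rfl, rfl⟩
    exact tensorWord_mem A l
  have htop : ⨆ γ, S γ = ⊤ := by
    rw [eq_top_iff, ← span_range_tensorWord, Submodule.span_le]
    rintro _ ⟨l, rfl⟩
    exact Submodule.mem_iSup_of_mem _ (Submodule.subset_span ⟨l, rfl, rfl⟩)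
  -- a spanning family of subspaces of the terms of a direct sum exhausts these terms
  have heq : S = TVprimeGrade A :=
    ((isInternal_TVprimeGrade A).submodule_iSupIndep.le_iff_eq_of_iSup_eq_top htop).1 hS
  rw [← heq]
  refine FiniteDimensional.span_of_finite K (Set.Finite.image _ ?_)
  by_cases h : ∃ m, negDeg m = β
  · obtain ⟨m, rfl⟩ := h
    exact (finite_tensorContent A m).subset fun l hl => negDeg_injective hl
  · convert Set.finite_empty
    exact Set.eq_empty_of_forall_notMem fun l hl => h ⟨_, hl⟩

theorem lie_mem_TVprimeGrade {α : J A →₀ ℤ} {β : I →₀ ℤ} {x : gJ A}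
    (hx : x ∈ rootSpace (cartanJ A) α) {t : TVprime A} (ht : t ∈ TVprimeGrade A β) :
    ⁅x, t⁆ ∈ TVprimeGrade A (α.mapDomain Subtype.val + β) :=
  TensorAlgebra.der_mem_gradeOf (VprimeGrade A) _ _
    (fun _ _ hv i => lie_mem_rootSpace A (toBorcherds_mem_rootSpace A hx) (hv i)) ht

theorem lie_h_TVprimeGrade (j : J A) {β : I →₀ ℤ} {t : TVprime A} (ht : t ∈ TVprimeGrade A β) :
    ⁅h (cartanJ A) j, t⁆ = evalCoroot A j β • t := by
  refine TensorAlgebra.der_eq_smul (VprimeGrade A) _ (evalCoroot A j) (fun β v hv => ?_) ht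
  refine DFinsupp.ext fun i => Subtype.ext ?_
  refine Eq.trans ?_ (lie_h_eq_smul A j (hv i))
  rw [← toBorcherds_h]
  rfl

/-! ### Weights and integrability -/

section Weights

variable (M : Type*) [AddCommGroup M] [Module K M] [LieRingModule (BorcherdsAlgebra A) M]
  [LieModule K (BorcherdsAlgebra A) M]

theorem isInternal_weightSpace [DecidableEq (Module.Dual K (cartan A))]
    (htop : ⨆ μ, weightSpace A M μ = ⊤) : DirectSum.IsInternal (weightSpace A M) :=
  DirectSum.isInternal_of_joint_eigenvectors (weightSpace A M)
    (fun x : cartan A => LieModule.toEnd K (BorcherdsAlgebra A) M (x : BorcherdsAlgebra A))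
    (fun μ x => μ x) DFunLike.coe_injective (fun _ x _ hv => hv x) htop

/-- A subspace on which every `h_i` acts as a scalar lies in a weight space. The weight is linear
on the Cartan subalgebra even though the `h_i` are not known to be linearly independent, because it
can be read off from any nonzero vector of the subspace. -/
theorem exists_le_weightSpace (N : Submodule K M) (c : I → K)
    (hc : ∀ i, ∀ v ∈ N, ⁅h A i, v⁆ = c i • v) : ∃ μ, N ≤ weightSpace A M μ := by
  have hex (x : cartan A) : ∃ a : K, ∀ v ∈ N, ⁅(x : BorcherdsAlgebra A), v⁆ = a • v := by
    obtain ⟨x, hx⟩ := x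
    induction hx using Submodule.span_induction with
    | mem x hx => obtain ⟨i, rfl⟩ := hx; exact ⟨c i, hc i⟩
    | zero => exact ⟨0, by simp⟩
    | add x y _ _ hx hy =>
      obtain ⟨a, ha⟩ := hx
      obtain ⟨b, hb⟩ := hy
      exact ⟨a + b, fun v hv => by
        simpa [add_smul] using congrArg₂ (· + ·) (ha v hv) (hb v hv)⟩
    | smul r x _ hx =>
      obtain ⟨a, ha⟩ := hx
      exact ⟨r * a, fun v hv => by simpa [mul_smul] using congrArg (r • ·) (ha v hv)⟩
  choose a ha using hex
  by_cases hN : N = ⊥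
  · exact ⟨0, hN ▸ bot_le⟩
  obtain ⟨w, hw, hw0⟩ := N.exists_mem_ne_zero_of_ne_bot hN
  have hinj : Function.Injective fun r : K => r • w := smul_left_injective K hw0
  let μ : Module.Dual K (cartan A) :=
    { toFun := a
      map_add' := fun x y => hinj <| by
        simp only [add_smul, ← ha _ w hw, ← add_lie]; rfl
      map_smul' := fun r x => hinj <| by
        simp only [RingHom.id_apply, smul_eq_mul, mul_smul, ← ha _ w hw, ← smul_lie]; rfl }
  exact ⟨μ, fun v hv x => ha x v hv⟩

end Weights

open scoped Classical in
theorem isIntegrable_TVprime (hA : IsBorcherdsMatrix A) :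
    IsIntegrable (cartanJ A) (TVprime A) where
  weight := by
    refine isInternal_weightSpace _ _ (eq_top_iff.2 ?_)
    rw [← iSup_TVprimeGrade A]
    refine iSup_le fun β => ?_
    obtain ⟨μ, hμ⟩ := exists_le_weightSpace (cartanJ A) (TVprime A) (TVprimeGrade A β)
      (fun j => evalCoroot A j β) fun j t ht => lie_h_TVprimeGrade A j ht
    exact hμ.trans (le_iSup _ μ)
  e_nilpotent j _ := exists_toEnd_TVprime_pow_eq_zero A _ fun i => by
    rw [toBorcherds_e]; exact VprimeI_le_engel_e A j i.1
  f_nilpotent j _ := exists_toEnd_TVprime_pow_eq_zero A _ fun i => by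
    rw [toBorcherds_f]; exact VprimeI_le_engel_f A hA j i.1

end Borcherds

end

open Borcherds in
open scoped Classical in
theorem corollary2p2 {I : Type*} [Countable I] (K : Subfield ℂ) (A : Matrix I I K)
    (hA : IsBorcherdsMatrix A)
    (hneg : ∀ i j : I, i ∉ J A → j ∉ J A → i ≠ j → (A i j : ℂ).re < 0) :
    -- integrable `𝔤_J`-module
    IsIntegrable (cartanJ A) (TVprime A) ∧
    -- `Q`-graded, as a vector space, as an algebra and as a `𝔤_J`-module
    DirectSum.IsInternal (TVprimeGrade A) ∧
    SetLike.GradedMonoid (TVprimeGrade A) ∧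
    (∀ (α : J A →₀ ℤ) (β : I →₀ ℤ), ∀ x ∈ rootSpace (cartanJ A) α, ∀ t ∈ TVprimeGrade A β,
      ⁅x, t⁆ ∈ TVprimeGrade A (α.mapDomain Subtype.val + β)) ∧
    -- the degree-`β` subspace has weight `β`, where `α_i (h_j) = a_ji`
    (∀ (β : I →₀ ℤ) (j : J A), ∀ t ∈ TVprimeGrade A β,
      ⁅h (cartanJ A) j, t⁆ = (β.sum fun i n => (n : K) * A j i) • t) ∧
    -- finite-dimensional homogeneous subspaces
    ∀ β : I →₀ ℤ, FiniteDimensional K (TVprimeGrade A β) := by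
  exact ⟨isIntegrable_TVprime A hA, isInternal_TVprimeGrade A,
    TensorAlgebra.gradedMonoid_gradeOf (VprimeGrade A),
    fun _ _ _ hx _ ht => lie_mem_TVprimeGrade A hx ht,
    fun _ j _ ht => lie_h_TVprimeGrade A j ht, finiteDimensional_TVprimeGrade A⟩
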